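/- A skew brace is a set $H$ with two group structures $(H,+)$ and $(H,\circ)$ such that $a\circ(b+c)=(a\circ b)-a+(a\circ c)$ for all $a,b,c\in H$; the two identities coincide and are denoted by $0$. Put $\lambda_a(b)=-a+(a\circ b)$ and $\Lambda_H=(H,+)\rtimes_\lambda(H,\circ)$, so $(h_1,g_1)(h_2,g_2)=(h_1+\lambda_{g_1}(h_2),\,g_1\circ g_2)$. The skew brace $H$ acts on an abelian group $I$ via a good triplet of actions $(\nu,\mu,\sigma)$ if $\nu:(H,\circ)\to\operatorname{Aut}(I)$ is a homomorphism, $\mu:(H,+)\to\operatorname{Aut}(I)$ and $\sigma:(H,\circ)\to\operatorname{Aut}(I)$ are anti-homomorphisms, and for all $a,b\in H$, $y\in I$, $$\mu_{\lambda_a(b)}(y)=\nu_a(\mu_b(\nu_a^{-1}(y))),\qquad \nu_{a+b}(\sigma_{a+b}(y))+\mu_b(y)=\mu_b(\nu_a(\sigma_a(y)))+\nu_b(\sigma_b(y)).$$ For a group $G$ with identity $e$ acting on an abelian group $M$ from the right through an anti-homomorphism $\rho:G\to\operatorname{Aut}(M)$, let $Z^2_{Gp}(G,M)$ be the group of normalized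 $2$-cocycles, i.e. maps $c:G\times G\to M$ with $c(x,e)=c(e,x)=0$ and $c(y,z)-c(xy,z)+c(x,yz)-\rho_z(c(x,y))=0$; let $B^2_{Gp}(G,M)$ be the subgroup of the maps $(x,y)\mapsto\theta(y)-\theta(xy)+\rho_y(\theta(x))$ with $\theta:G\to M$, $\theta(e)=0$; and put $H^2_{Gp}(G,M)=Z^2_{Gp}(G,M)/B^2_{Gp}(G,M)$. Let $H$ act on $I$ via a good triplet $(\nu,\mu,\sigma)$. For $\tau:H\times H\to I$ put $\bar\tau(h_1,h_2)=\nu_{h_1\circ h_2}^{-1}(\tau(h_1,h_2))$. Let $Z^2_{Sb}(H,I)$ be the group of pairs $(\beta,\tau)$ of maps $H\times H\to I$ such that $\beta\in Z^2_{Gp}((H,+),I)$ (for the action $\mu$), $\bar\tau\in Z^2_{Gp}((H,\circ),I)$ (for the action $\sigma$), and for all $h_1,h_2,h_3\in H$ $$\mu_{\lambda_{h_1}(h_3)}(\tau(h_1,h_2))-\tau(h_1,h_2+h_3)+\tau(h_1,h_3)=\nu_{h_1}(\beta(h_2,h_3))+\mu_{h_1\circ h_3}(\beta(h_1,-h_1))-\beta(-h_1,h_1\circ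 h_3)-\beta(h_1\circ h_2,\lambda_{h_1}(h_3)).$$ Let $B^2_{Sb}(H,I)$ be its subgroup of the pairs $$\beta(h_1,h_2)=\theta(h_2)-\theta(h_1+h_2)+\mu_{h_2}(\theta(h_1)),\qquad \tau(h_1,h_2)=\nu_{h_1}(\theta(h_2))-\theta(h_1\circ h_2)+\nu_{h_1\circ h_2}(\sigma_{h_2}(\nu_{h_1}^{-1}(\theta(h_1))))$$ with $\theta:H\to I$, $\theta(0)=0$, and put $H^2_{Sb}(H,I)=Z^2_{Sb}(H,I)/B^2_{Sb}(H,I)$. Let $\Lambda_H$ act on $I\times I$ from the right by $$\chi_{(h,g)}(x,y)=\bigl(\nu_g^{-1}(\mu_h(x-y))+\nu_g^{-1}(\nu_h(\sigma_h(y))),\ \sigma_g(y)\bigr),$$ and for maps $\beta,\tau:H\times H\to I$ put $f(g,h)=\beta(-g,g\circ h)-\mu_{g\circ h}(\beta(g,-g))+\tau(g,h)$ and $$(\phi_{\beta,\tau},\bar\tau)\bigl((h_1,g_1),(h_2,g_2)\bigr)=\Bigl(\nu^{-1}_{g_1\circ g_2}\bigl(\beta(h_1,\lambda_{g_1}(h_2))+f(g_1,h_2)\bigr),\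 \bar\tau(g_1,g_2)\Bigr).$$ **Theorem.** For every $(\beta,\tau)\in Z^2_{Sb}(H,I)$ the map $(\phi_{\beta,\tau},\bar\tau)$ lies in $Z^2_{Gp}(\Lambda_H,I\times I)$, and $$\Psi:H^2_{Sb}(H,I)\to H^2_{Gp}(\Lambda_H,I\times I),\qquad \Psi([(\beta,\tau)])=[(\phi_{\beta,\tau},\bar\tau)]$$ is a well-defined group homomorphism. If moreover $\mu_h=\operatorname{id}$ and $\nu_h^{-1}=\sigma_h$ for all $h\in H$, then $\Psi$ is injective. -/

import Mathlib

/-- A skew left brace: a set with two group structures, written `+` (the additive group, not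
necessarily commutative) and `*` (the multiplicative group, usually written `∘`), such that
`a ∘ (b + c) = (a ∘ b) - a + (a ∘ c)`. -/
class SkewBrace (A : Type*) extends AddGroup A, Group A where
  mul_add_skew : ∀ a b c : A, a * (b + c) = a * b - a + a * c

namespace SkewBrace

variable {A : Type*} [SkewBrace A]

theorem mul_zero_skew (a : A) : a * 0 = a := by
  have h := mul_add_skew a 0 0
  rw [add_zero, sub_eq_add_neg, add_assoc] at h
  have h2 : -a + a * 0 = 0 := by
    have := congrArg (fun t => -(a * 0) + t) h
    simpa using this.symm
  exact (neg_add_eq_zero.mp h2).symm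

theorem zero_eq_one : (0 : A) = 1 := mul_left_cancel (a := (1 : A)) (by
  rw [mul_zero_skew, mul_one])

/-- The additive automorphism `λ_a(b) = -a + (a ∘ b)`. -/
def lam (a : A) : A ≃+ A where
  toFun b := -a + a * b
  invFun b := a⁻¹ * (a + b)
  left_inv b := by simp
  right_inv b := by simp
  map_add' b c := by rw [mul_add_skew, sub_eq_add_neg]; simp only [add_assoc]

theorem lam_apply (a b : A) : lam a b = -a + a * b := rfl

theorem lam_mul (a b c : A) : lam (a * b) c = lam a (lam b c) := by
  have h : lam a (lam b c) = lam a (-b) + lam a (b * c) := by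
    rw [lam_apply b c, map_add]
  rw [h, map_neg, lam_apply, lam_apply, lam_apply, mul_assoc]
  simp [add_assoc]

theorem lam_one (c : A) : lam (1 : A) c = c := by
  rw [lam_apply, ← zero_eq_one, neg_zero, zero_add, zero_eq_one, one_mul]

/-- The lambda map `λ : (A, ∘) → Aut (A, +)` as a group homomorphism, `Multiplicative A` being the
group `(A, +)` written multiplicatively. -/
def lamHom (A : Type*) [SkewBrace A] : A →* MulAut (Multiplicative A) where
  toFun a := AddEquiv.toMultiplicative (lam a)
  map_one' := by
    ext x
    exact congrArg Multiplicative.ofAdd (lam_one x.toAdd)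
  map_mul' a b := by
    ext x
    exact congrArg Multiplicative.ofAdd (lam_mul a b x.toAdd)

/-- The group `Λ_A = (A, +) ⋊_λ (A, ∘)`, with
`(x₁, y₁) (x₂, y₂) = (x₁ + λ_{y₁}(x₂), y₁ ∘ y₂)`. -/
abbrev Lambda (A : Type*) [SkewBrace A] : Type _ :=
  SemidirectProduct (Multiplicative A) A (lamHom A)

end SkewBrace

/-! ### Second group cohomology with coefficients in a right module -/

/-- An action of a group `G` on an abelian group `M` by automorphisms from the right, that is, an
anti-homomorphism `ρ : G → Aut M`, written `ρ.act g : M ≃+ M`. -/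
structure RightAction (G M : Type*) [Group G] [AddCommGroup M] where
  act : G → (M ≃+ M)
  act_mul : ∀ (x y : G) (m : M), act (x * y) m = act y (act x m)

namespace RightCohomology

variable {G M : Type*} [Group G] [AddCommGroup M]

/-- Normalized 2-cocycles of a group `G` with coefficients in an abelian group `M` on which `G`
acts from the right by `ρ`:
`c(y, z) - c(xy, z) + c(x, yz) - ρ_z(c(x, y)) = 0` and `c(x, 1) = c(1, x) = 0`. -/
def Z2 (ρ : RightAction G M) : AddSubgroup (G → G → M) where
  carrier := {c | (∀ x y z : G,
      c y z - c (x * y) z + c x (y * z) - ρ.act z (c x y) = 0) ∧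
      ∀ x : G, c x 1 = 0 ∧ c 1 x = 0}
  zero_mem' := by simp
  add_mem' := by
    rintro c d ⟨hc, hc'⟩ ⟨hd, hd'⟩
    refine ⟨fun x y z => ?_, fun x => ?_⟩
    · have h := congrArg₂ (· + ·) (hc x y z) (hd x y z)
      simp only [Pi.add_apply, map_add, add_zero] at h ⊢
      rw [← h]; abel
    · simp [(hc' x).1, (hc' x).2, (hd' x).1, (hd' x).2]
  neg_mem' := by
    rintro c ⟨hc, hc'⟩
    refine ⟨fun x y z => ?_, fun x => ?_⟩
    · have h := congrArg Neg.neg (hc x y z)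
      simp only [Pi.neg_apply, map_neg, neg_zero] at h ⊢
      rw [← h]; abel
    · simp [(hc' x).1, (hc' x).2]

/-- The 2-coboundaries `(x, y) ↦ θ(y) - θ(xy) + ρ_y(θ(x))` of the normalized 1-cochains `θ`. -/
def B2 (ρ : RightAction G M) : AddSubgroup (G → G → M) where
  carrier := {c | ∃ θ : G → M, θ 1 = 0 ∧
    ∀ x y : G, c x y = θ y - θ (x * y) + ρ.act y (θ x)}
  zero_mem' := ⟨0, by simp⟩
  add_mem' := by
    rintro c d ⟨θ, h1, hc⟩ ⟨η, h2, hd⟩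
    refine ⟨θ + η, by simp [h1, h2], fun x y => ?_⟩
    simp only [Pi.add_apply, map_add, hc, hd]; abel
  neg_mem' := by
    rintro c ⟨θ, h1, hc⟩
    refine ⟨-θ, by simp [h1], fun x y => ?_⟩
    simp only [Pi.neg_apply, map_neg, hc]; abel

theorem B2_le_Z2 (ρ : RightAction G M) : B2 ρ ≤ Z2 ρ := by
  rintro c ⟨θ, h1, hc⟩
  refine ⟨fun x y z => ?_, fun x => ?_⟩
  · simp only [hc, map_add, map_sub, ρ.act_mul, mul_assoc]; abel
  · have h : ρ.act 1 (θ x) = θ x := (ρ.act 1).injective (by rw [← ρ.act_mul, mul_one])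
    simp [hc, h1, h]

/-- `H²(G, M) = Z²(G, M) / B²(G, M)` for the right action `ρ`. -/
abbrev H2 (ρ : RightAction G M) : Type _ := Z2 ρ ⧸ (B2 ρ).addSubgroupOf (Z2 ρ)

end RightCohomology

open SkewBrace in
/-- A good triplet of actions `(ν, μ, σ)` of a skew brace `H` on an abelian group `I`:
`ν : (H, ∘) → Aut I` is a homomorphism, `μ : (H, +) → Aut I` and `σ : (H, ∘) → Aut I` are
anti-homomorphisms, and the two compatibility conditions hold. -/
structure GoodTriplet (H I : Type*) [SkewBrace H] [AddCommGroup I] where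
  ν : H → (I ≃+ I)
  μ : H → (I ≃+ I)
  σ : H → (I ≃+ I)
  ν_mul : ∀ (a b : H) (y : I), ν (a * b) y = ν a (ν b y)
  μ_add : ∀ (a b : H) (y : I), μ (a + b) y = μ b (μ a y)
  σ_mul : ∀ (a b : H) (y : I), σ (a * b) y = σ b (σ a y)
  compat₁ : ∀ (a b : H) (y : I), μ (lam a b) y = ν a (μ b ((ν a).symm y))
  compat₂ : ∀ (a b : H) (y : I),
    ν (a + b) (σ (a + b) y) + μ b y = μ b (ν a (σ a y)) + ν b (σ b y)

namespace GoodTriplet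

open SkewBrace

variable {H I : Type*} [SkewBrace H] [AddCommGroup I] (T : GoodTriplet H I)

/-- The right action `μ` of `(H, +)` on `I`. -/
def μAct : RightAction (Multiplicative H) I where
  act h := T.μ h.toAdd
  act_mul a b y := T.μ_add a.toAdd b.toAdd y

/-- The right action `σ` of `(H, ∘)` on `I`. -/
def σAct : RightAction H I where
  act := T.σ
  act_mul := T.σ_mul

/-- The automorphism
`χ_{(h,g)}(x, y) = (ν_g⁻¹(μ_h(x - y)) + ν_g⁻¹(ν_h(σ_h(y))), σ_g(y))` of `I × I`. -/
def chiAut (h g : H) : (I × I) ≃+ (I × I) where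
  toFun p := ((T.ν g).symm (T.μ h (p.1 - p.2)) + (T.ν g).symm (T.ν h (T.σ h p.2)), T.σ g p.2)
  invFun p := ((T.σ g).symm p.2 +
    (T.μ h).symm (T.ν g p.1 - T.ν h (T.σ h ((T.σ g).symm p.2))), (T.σ g).symm p.2)
  left_inv p := by
    ext <;> simp
  right_inv p := by
    ext <;> simp
  map_add' p q := by
    ext <;> simp [map_add, map_sub]
    abel

theorem chiAut_mul (h₁ g₁ h₂ g₂ : H) (p : I × I) :
    T.chiAut (h₁ + lam g₁ h₂) (g₁ * g₂) p = T.chiAut h₂ g₂ (T.chiAut h₁ g₁ p) := by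
  obtain ⟨x, y⟩ := p
  have e1 : ∀ z, (T.ν (g₁ * g₂)).symm z = (T.ν g₂).symm ((T.ν g₁).symm z) := by
    intro z; rw [AddEquiv.symm_apply_eq, T.ν_mul]; simp
  have e2 : g₁ + lam g₁ h₂ = g₁ * h₂ := by rw [lam_apply]; simp
  have c1 := T.compat₂ g₁ (lam g₁ h₂) y
  have c2 := T.compat₂ h₁ (lam g₁ h₂) y
  rw [e2, T.ν_mul, T.σ_mul] at c1
  have k : ∀ z, (T.ν g₁).symm (T.μ (lam g₁ h₂) z) = T.μ h₂ ((T.ν g₁).symm z) := by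
    intro z; rw [T.compat₁]; simp
  have c1' := congrArg (T.ν g₁).symm c1
  have c2' := congrArg (T.ν g₁).symm c2
  simp only [map_add, k, AddEquiv.symm_apply_apply] at c1' c2'
  have c3 : (T.ν g₁).symm (T.ν (h₁ + lam g₁ h₂) (T.σ (h₁ + lam g₁ h₂) y)) =
      T.μ h₂ ((T.ν g₁).symm (T.ν h₁ (T.σ h₁ y))) - T.μ h₂ (T.σ g₁ y)
        + T.ν h₂ (T.σ h₂ (T.σ g₁ y)) := by
    have a1 := eq_sub_of_add_eq c2'
    have a2 := eq_sub_of_add_eq c1'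
    rw [a1, a2]; abel
  refine Prod.ext ?_ (T.σ_mul _ _ y)
  change (T.ν (g₁ * g₂)).symm (T.μ (h₁ + lam g₁ h₂) (x - y)) + (T.ν (g₁ * g₂)).symm
      (T.ν (h₁ + lam g₁ h₂) (T.σ (h₁ + lam g₁ h₂) y)) =
    (T.ν g₂).symm (T.μ h₂ (((T.ν g₁).symm (T.μ h₁ (x - y)) + (T.ν g₁).symm (T.ν h₁ (T.σ h₁ y)))
      - T.σ g₁ y)) + (T.ν g₂).symm (T.ν h₂ (T.σ h₂ (T.σ g₁ y)))
  rw [e1, e1, c3, T.μ_add, k]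
  simp only [map_add, map_sub]
  abel

/-- The right action `χ` of `Λ_H` on `I × I`. -/
def chi : RightAction (Lambda H) (I × I) where
  act p := T.chiAut p.left.toAdd p.right
  act_mul p q := T.chiAut_mul p.left.toAdd p.right q.left.toAdd q.right

/-! ### Second cohomology of skew braces -/

/-- `τ̄(h₁, h₂) = ν_{h₁ ∘ h₂}⁻¹(τ(h₁, h₂))`. -/
def tauBar (τ : H → H → I) : H → H → I := fun h₁ h₂ => (T.ν (h₁ * h₂)).symm (τ h₁ h₂)

/-- Brace 2-cocycles: pairs `(β, τ)` such that `β` is a (normalized) 2-cocycle of `(H, +)` for the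
right action `μ`, `τ̄` is a (normalized) 2-cocycle of `(H, ∘)` for the right action `σ`, and
the mutual compatibility equation holds. -/
def Z2Sb : AddSubgroup ((H → H → I) × (H → H → I)) where
  carrier := {c |
    (fun a b : Multiplicative H => c.1 a.toAdd b.toAdd) ∈ RightCohomology.Z2 T.μAct ∧
    T.tauBar c.2 ∈ RightCohomology.Z2 T.σAct ∧
    ∀ h₁ h₂ h₃ : H,
      T.μ (lam h₁ h₃) (c.2 h₁ h₂) - c.2 h₁ (h₂ + h₃) + c.2 h₁ h₃ =
        T.ν h₁ (c.1 h₂ h₃) + T.μ (h₁ * h₃) (c.1 h₁ (-h₁)) - c.1 (-h₁) (h₁ * h₃)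
          - c.1 (h₁ * h₂) (lam h₁ h₃)}
  zero_mem' := by
    refine ⟨AddSubgroup.zero_mem _, ?_, fun h₁ h₂ h₃ => by simp⟩
    have e : T.tauBar (0 : H → H → I) = 0 := by
      funext a b; exact map_zero _
    exact e ▸ AddSubgroup.zero_mem _
  add_mem' := by
    rintro c d ⟨c1, c2, c3⟩ ⟨d1, d2, d3⟩
    refine ⟨AddSubgroup.add_mem _ c1 d1, ?_, fun h₁ h₂ h₃ => ?_⟩
    · have e : T.tauBar (c + d).2 = T.tauBar c.2 + T.tauBar d.2 := by
        funext a b; exact map_add _ _ _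
      exact e ▸ AddSubgroup.add_mem _ c2 d2
    · have h := congrArg₂ (· + ·) (c3 h₁ h₂ h₃) (d3 h₁ h₂ h₃)
      simp only [Prod.fst_add, Prod.snd_add, Pi.add_apply, map_add] at h ⊢
      rw [← sub_eq_zero] at h ⊢
      rw [← h]; abel
  neg_mem' := by
    rintro c ⟨c1, c2, c3⟩
    refine ⟨AddSubgroup.neg_mem _ c1, ?_, fun h₁ h₂ h₃ => ?_⟩
    · have e : T.tauBar (-c).2 = -T.tauBar c.2 := by
        funext a b; exact map_neg _ _
      exact e ▸ AddSubgroup.neg_mem _ c2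
    · have h := congrArg Neg.neg (c3 h₁ h₂ h₃)
      simp only [Prod.fst_neg, Prod.snd_neg, Pi.neg_apply, map_neg] at h ⊢
      rw [← sub_eq_zero] at h ⊢
      rw [← h]; abel

/-- Brace 2-coboundaries: for an extension `E` with st-section `s` and `θ : H → I`, `θ(0) = 0`,
these are the differences between the cocycle of the st-section `h ↦ s(h) + θ(h)` and that
of `s`. -/
def B2Sb : AddSubgroup ((H → H → I) × (H → H → I)) where
  carrier := {c | ∃ θ : H → I, θ 0 = 0 ∧ ∀ h₁ h₂ : H,
    c.1 h₁ h₂ = θ h₂ - θ (h₁ + h₂) + T.μ h₂ (θ h₁) ∧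
    c.2 h₁ h₂ = T.ν h₁ (θ h₂) - θ (h₁ * h₂) + T.ν (h₁ * h₂) (T.σ h₂ ((T.ν h₁).symm (θ h₁)))}
  zero_mem' := ⟨0, by simp⟩
  add_mem' := by
    rintro c d ⟨θ, h1, hc⟩ ⟨η, h2, hd⟩
    refine ⟨θ + η, by simp [h1, h2], fun x y => ⟨?_, ?_⟩⟩
    · simp only [Prod.fst_add, Pi.add_apply, map_add, (hc x y).1, (hd x y).1]; abel
    · simp only [Prod.snd_add, Pi.add_apply, map_add, (hc x y).2, (hd x y).2]; abel
  neg_mem' := by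
    rintro c ⟨θ, h1, hc⟩
    refine ⟨-θ, by simp [h1], fun x y => ⟨?_, ?_⟩⟩
    · simp only [Prod.fst_neg, Pi.neg_apply, map_neg, (hc x y).1]; abel
    · simp only [Prod.snd_neg, Pi.neg_apply, map_neg, (hc x y).2]; abel

theorem B2Sb_le_Z2Sb : T.B2Sb ≤ T.Z2Sb := by
  rintro c ⟨θ, h0, hc⟩
  have μ0 : ∀ z, T.μ 0 z = z := fun z => (T.μ 0).injective (by rw [← T.μ_add, add_zero])
  refine ⟨RightCohomology.B2_le_Z2 _ ⟨fun a => θ a.toAdd, h0, fun a b => (hc _ _).1⟩,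
    RightCohomology.B2_le_Z2 _ ⟨fun a => (T.ν a).symm (θ a), ?_, fun a b => ?_⟩,
    fun a b d => ?_⟩
  · change (T.ν 1).symm (θ 1) = 0
    rw [← zero_eq_one, h0, map_zero]
  · change (T.ν (a * b)).symm (c.2 a b) = (T.ν b).symm (θ b) -
      (T.ν (a * b)).symm (θ (a * b)) + T.σ b ((T.ν a).symm (θ a))
    rw [AddEquiv.symm_apply_eq, (hc a b).2]
    simp only [map_add, map_sub, AddEquiv.apply_symm_apply]
    rw [T.ν_mul a b ((T.ν b).symm _), AddEquiv.apply_symm_apply]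
  · obtain ⟨z, hz⟩ : ∃ z, θ a = T.ν a z := ⟨_, ((T.ν a).apply_symm_apply _).symm⟩
    have e1 : a * d = a + lam a d := by rw [lam_apply]; simp
    have e2 : a * (b + d) = a * b + lam a d := by
      rw [mul_add_skew, lam_apply, sub_eq_add_neg, add_assoc]
    have e3 : ∀ y, T.μ (lam a d) (T.ν a y) = T.ν a (T.μ d y) := by
      intro y; rw [T.compat₁]; simp
    have e4 : -a + a * d = lam a d := rfl
    have k := congrArg (T.ν a) (T.compat₂ b d z)
    simp only [map_add] at k
    have k' := eq_sub_of_add_eq k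
    have hm : T.μ (a * d) (T.μ (-a) (θ a)) = T.ν a (T.μ d z) := by
      rw [← T.μ_add, e4, hz, e3]
    have h1 : T.ν (a * b) (T.σ b z) = T.ν a (T.ν b (T.σ b z)) := T.ν_mul _ _ _
    have h2 : T.ν (a * d) (T.σ d z) = T.ν a (T.ν d (T.σ d z)) := T.ν_mul _ _ _
    have h3 : T.ν (a * (b + d)) (T.σ (b + d) z) = T.ν a (T.ν (b + d) (T.σ (b + d) z)) :=
      T.ν_mul _ _ _
    simp only [(hc _ _).1, (hc _ _).2, map_add, map_sub, add_neg_cancel, h0, map_zero, e4,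
      ← e2, hm]
    simp only [hz, AddEquiv.symm_apply_apply, h1, h2, h3, k', e3]
    abel

/-- `H²_Sb(H, I) = Z²_Sb(H, I) / B²_Sb(H, I)`. -/
abbrev H2Sb : Type _ := T.Z2Sb ⧸ T.B2Sb.addSubgroupOf T.Z2Sb

/-! ### The associated 2-cocycle of `Λ_H` -/

/-- `f(g, h) = β(-g, g ∘ h) - μ_{g ∘ h}(β(g, -g)) + τ(g, h)`. -/
def fMap (β τ : H → H → I) (g h : H) : I :=
  β (-g) (g * h) - T.μ (g * h) (β g (-g)) + τ g h

/-- `φ_{β,τ}((h₁, g₁), (h₂, g₂)) = ν_{g₁ ∘ g₂}⁻¹(β(h₁, λ_{g₁}(h₂)) + f(g₁, h₂))`. -/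
def phi (β τ : H → H → I) : Lambda H → Lambda H → I := fun p q =>
  (T.ν (p.right * q.right)).symm
    (β p.left.toAdd (lam p.right q.left.toAdd) + T.fMap β τ p.right q.left.toAdd)

/-- The map `(φ_{β,τ}, τ̄) : Λ_H × Λ_H → I × I`. -/
def cocycleMap (β τ : H → H → I) : Lambda H → Lambda H → I × I := fun p q =>
  (T.phi β τ p q, T.tauBar τ p.right q.right)

end GoodTriplet

namespace SkewBrace

variable {H : Type*} [SkewBrace H]

/-! The additive cocycle identity for `β` rewrites `f(g, h)` as `τ(g, h) - β(g, λ_g(h))`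
(`fMap_eq`), so all additive inverses disappear. The cocycle identity for `φ`, cleared of inverse
`ν`'s, is then a signed sum of two additive identities for `β` and two `β`-`τ` compatibilities, once
the cocycle identity for `τ̄` has replaced the `σ`-term of `χ`.

A brace cochain `θ` yields the cochain `(h, g) ↦ (ν_g⁻¹ θ(h), ν_g⁻¹ θ(g))` of `Λ_H`, so coboundaries
go to coboundaries and `Ψ` is defined.

For injectivity, `μ = id` and `σ = ν⁻¹` turn the first coordinate of `χ` into `x ↦ ν_g⁻¹(x)`. The
first coordinate `η` of a bounding cochain therefore satisfies an equation of its own, and `θ(h) =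
η(h, 1)` bounds both `β` and `τ`. -/

theorem add_lam (a b : H) : a + lam a b = a * b := by rw [lam_apply]; simp

end SkewBrace

namespace GoodTriplet

open SkewBrace

variable {H I : Type*} [SkewBrace H] [AddCommGroup I] (T : GoodTriplet H I)

theorem ν_mul_symm (a b : H) (y : I) :
    (T.ν (a * b)).symm y = (T.ν b).symm ((T.ν a).symm y) := by
  rw [AddEquiv.symm_apply_eq, T.ν_mul]; simp

theorem ν_one (y : I) : T.ν 1 y = y :=
  (T.ν 1).injective (by rw [← T.ν_mul, mul_one])

theorem ν_one_symm (y : I) : (T.ν 1).symm y = y := by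
  rw [AddEquiv.symm_apply_eq, T.ν_one]

/-! ### Identities satisfied by a brace cocycle -/

variable {T}

theorem beta_cocycle {c : (H → H → I) × (H → H → I)} (hc : c ∈ T.Z2Sb) (x y z : H) :
    c.1 y z - c.1 (x + y) z + c.1 x (y + z) - T.μ z (c.1 x y) = 0 :=
  hc.1.1 (Multiplicative.ofAdd x) (Multiplicative.ofAdd y) (Multiplicative.ofAdd z)

theorem beta_zero_right {c : (H → H → I) × (H → H → I)} (hc : c ∈ T.Z2Sb) (x : H) :
    c.1 x 0 = 0 :=
  (hc.1.2 (Multiplicative.ofAdd x)).1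

theorem beta_zero_left {c : (H → H → I) × (H → H → I)} (hc : c ∈ T.Z2Sb) (x : H) :
    c.1 0 x = 0 :=
  (hc.1.2 (Multiplicative.ofAdd x)).2

theorem tau_one_right {c : (H → H → I) × (H → H → I)} (hc : c ∈ T.Z2Sb) (x : H) :
    c.2 x 1 = 0 := by
  simpa [tauBar] using (hc.2.1.2 x).1

theorem tau_one_left {c : (H → H → I) × (H → H → I)} (hc : c ∈ T.Z2Sb) (x : H) :
    c.2 1 x = 0 := by
  simpa [tauBar] using (hc.2.1.2 x).2

/-- The cocycle condition for `τ̄`, expressed through `τ`. -/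
theorem tau_cocycle {c : (H → H → I) × (H → H → I)} (hc : c ∈ T.Z2Sb) (x y z : H) :
    T.ν (x * y) (T.ν z (T.σ z ((T.ν (x * y)).symm (c.2 x y)))) =
      T.ν x (c.2 y z) - c.2 (x * y) z + c.2 x (y * z) := by
  have h : T.tauBar c.2 y z - T.tauBar c.2 (x * y) z + T.tauBar c.2 x (y * z)
      - T.σ z (T.tauBar c.2 x y) = 0 := hc.2.1.1 x y z
  have h' := congrArg (T.ν (x * y * z)) (sub_eq_zero.mp h)
  rw [← T.ν_mul]
  refine h'.symm.trans ?_
  simp only [tauBar, map_add, map_sub]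
  rw [← mul_assoc x y z, AddEquiv.apply_symm_apply, AddEquiv.apply_symm_apply, mul_assoc x y z,
    T.ν_mul x (y * z), AddEquiv.apply_symm_apply]

/-- On brace cocycles, `f(g, h) = τ(g, h) - β(g, λ_g(h))`. -/
theorem fMap_eq {c : (H → H → I) × (H → H → I)} (hc : c ∈ T.Z2Sb) (g h : H) :
    T.fMap c.1 c.2 g h = c.2 g h - c.1 g (lam g h) := by
  -- In this triple the outer sums are `g + (-g) = 0` and `-g + g ∘ h = λ_g(h)`.
  have k := beta_cocycle hc g (-g) (g * h)
  rw [add_neg_cancel, beta_zero_left hc, ← lam_apply] at k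
  rw [fMap, ← sub_eq_zero, ← k]
  abel

/-- The compatibility between `β` and `τ`, with the inverse eliminated. -/
theorem beta_tau_compat {c : (H → H → I) × (H → H → I)} (hc : c ∈ T.Z2Sb) (a b d : H) :
    T.μ (lam a d) (c.2 a b) - c.2 a (b + d) + c.2 a d =
      T.ν a (c.1 b d) + c.1 a (lam a d) - c.1 (a * b) (lam a d) := by
  have k := fMap_eq hc a d
  rw [fMap] at k
  have k' : c.1 (-a) (a * d) - T.μ (a * d) (c.1 a (-a)) = -c.1 a (lam a d) := by
    rw [eq_sub_of_add_eq k]; abel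
  rw [hc.2.2 a b d, ← neg_neg (c.1 a (lam a d)), ← k']
  abel

/-! ### The associated map is a cocycle of `Λ_H` -/

theorem cocycleMap_mem_Z2 {c : (H → H → I) × (H → H → I)} (hc : c ∈ T.Z2Sb) :
    T.cocycleMap c.1 c.2 ∈ RightCohomology.Z2 T.chi := by
  refine ⟨fun p q r => Prod.ext ?_ (hc.2.1.1 p.right q.right r.right),
    fun p => ⟨Prod.ext ?_ (hc.2.1.2 p.right).1, Prod.ext ?_ (hc.2.1.2 p.right).2⟩⟩
  · obtain ⟨h₁, g₁⟩ := p
    obtain ⟨h₂, g₂⟩ := q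
    obtain ⟨h₃, g₃⟩ := r
    change H at h₁ h₂ h₃
    change (T.ν (g₂ * g₃)).symm (c.1 h₂ (lam g₂ h₃) + T.fMap c.1 c.2 g₂ h₃)
      - (T.ν (g₁ * g₂ * g₃)).symm
          (c.1 (h₁ + lam g₁ h₂) (lam (g₁ * g₂) h₃) + T.fMap c.1 c.2 (g₁ * g₂) h₃)
      + (T.ν (g₁ * (g₂ * g₃))).symm
          (c.1 h₁ (lam g₁ (h₂ + lam g₂ h₃)) + T.fMap c.1 c.2 g₁ (h₂ + lam g₂ h₃))
      - ((T.ν g₃).symm (T.μ h₃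
          ((T.ν (g₁ * g₂)).symm (c.1 h₁ (lam g₁ h₂) + T.fMap c.1 c.2 g₁ h₂)
            - (T.ν (g₁ * g₂)).symm (c.2 g₁ g₂)))
        + (T.ν g₃).symm (T.ν h₃ (T.σ h₃ ((T.ν (g₁ * g₂)).symm (c.2 g₁ g₂))))) = 0
    -- This clears the outer inverses; the remaining conjugate of `μ_{h₃}` is `μ` at `λ_{g₁ ∘
    -- g₂}(h₃)`, by `compat₁`.
    apply (T.ν (g₁ * (g₂ * g₃))).injective
    have n₁ : ∀ z, T.ν (g₁ * (g₂ * g₃)) ((T.ν (g₂ * g₃)).symm z) = T.ν g₁ z := by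
      intro z; rw [T.ν_mul, AddEquiv.apply_symm_apply]
    have n₂ : ∀ z, T.ν (g₁ * (g₂ * g₃)) ((T.ν g₃).symm z) = T.ν (g₁ * g₂) z := by
      intro z; rw [← mul_assoc, T.ν_mul, AddEquiv.apply_symm_apply]
    have n₃ : ∀ z, T.ν (g₁ * g₂) (T.μ h₃ ((T.ν (g₁ * g₂)).symm z)) =
        T.μ (lam (g₁ * g₂) h₃) z := by
      intro z; rw [← T.compat₁]
    -- The `β`-part of `φ` is a difference of values with first argument `h₁` and `g₁`, hence one
    -- additive identity for each.
    have b₁ := beta_cocycle hc h₁ (lam g₁ h₂) (lam g₁ (lam g₂ h₃))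
    have b₂ := beta_cocycle hc g₁ (lam g₁ h₂) (lam g₁ (lam g₂ h₃))
    have k₁ := beta_tau_compat hc g₁ h₂ (lam g₂ h₃)
    have k₂ := beta_tau_compat hc g₁ g₂ (lam g₂ h₃)
    rw [add_lam] at b₂ k₂
    simp only [mul_assoc g₁ g₂ g₃, map_add, map_sub, n₁, n₂, n₃, AddEquiv.apply_symm_apply,
      fMap_eq hc, tau_cocycle hc, map_zero, lam_mul]
    rw [← sub_eq_zero] at k₁ k₂
    -- The identity sought is the combination `b₁ - b₂ + k₂ - k₁`.
    have e := congrArg₂ (· + ·) (congrArg₂ (· - ·) b₁ b₂) (congrArg₂ (· - ·) k₂ k₁)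
    simp only [sub_zero, add_zero] at e
    rw [← e]
    abel
  · change (T.ν (p.right * 1)).symm (c.1 p.left.toAdd (lam p.right 0) +
      T.fMap c.1 c.2 p.right 0) = 0
    rw [fMap_eq hc, map_zero, beta_zero_right hc, beta_zero_right hc, zero_eq_one,
      tau_one_right hc]
    simp
  · change (T.ν (1 * p.right)).symm (c.1 0 (lam 1 p.left.toAdd) +
      T.fMap c.1 c.2 1 p.left.toAdd) = 0
    rw [fMap_eq hc, ← zero_eq_one, beta_zero_left hc, zero_eq_one, tau_one_left hc]
    simp

/-! ### Coboundaries go to coboundaries -/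

theorem cocycleMap_mem_B2 {c : (H → H → I) × (H → H → I)} (hc : c ∈ T.B2Sb) :
    T.cocycleMap c.1 c.2 ∈ RightCohomology.B2 T.chi := by
  have hZ := T.B2Sb_le_Z2Sb hc
  obtain ⟨θ, h0, hθ⟩ := hc
  -- The second coordinate is the cochain bounding `τ̄`. The term `x - y` in `χ` then produces
  -- `θ(h₁) - θ(g₁)`, matching `β(h₁, ·) - β(g₁, ·)` in `φ`.
  refine ⟨fun p => ((T.ν p.right).symm (θ p.left.toAdd), (T.ν p.right).symm (θ p.right)),
    Prod.ext ?_ ?_, fun p q => ?_⟩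
  · change (T.ν 1).symm (θ 0) = 0
    rw [h0, map_zero]
  · change (T.ν 1).symm (θ 1) = 0
    rw [← zero_eq_one, h0, map_zero]
  · obtain ⟨h₁, g₁⟩ := p
    obtain ⟨h₂, g₂⟩ := q
    change H at h₁ h₂
    refine Prod.ext ?_ ?_
    · change (T.ν (g₁ * g₂)).symm (c.1 h₁ (lam g₁ h₂) + T.fMap c.1 c.2 g₁ h₂) =
        (T.ν g₂).symm (θ h₂) - (T.ν (g₁ * g₂)).symm (θ (h₁ + lam g₁ h₂))
          + ((T.ν g₂).symm (T.μ h₂ ((T.ν g₁).symm (θ h₁) - (T.ν g₁).symm (θ g₁)))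
            + (T.ν g₂).symm (T.ν h₂ (T.σ h₂ ((T.ν g₁).symm (θ g₁)))))
      have n : ∀ z, (T.ν g₁).symm (T.μ (lam g₁ h₂) z) = T.μ h₂ ((T.ν g₁).symm z) := by
        intro z; rw [T.compat₁, AddEquiv.symm_apply_apply]
      simp only [fMap_eq hZ, (hθ _ _).1, (hθ _ _).2, add_lam, T.ν_mul_symm, map_add, map_sub, n,
        T.ν_mul, AddEquiv.symm_apply_apply]
      abel
    · change (T.ν (g₁ * g₂)).symm (c.2 g₁ g₂) = (T.ν g₂).symm (θ g₂) -
        (T.ν (g₁ * g₂)).symm (θ (g₁ * g₂)) + T.σ g₂ ((T.ν g₁).symm (θ g₁))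
      simp only [(hθ _ _).2, T.ν_mul_symm, map_add, map_sub, T.ν_mul, AddEquiv.symm_apply_apply]

/-! ### Injectivity for trivial `μ` and `σ = ν⁻¹` -/

/-- If `μ` is trivial and `σ = ν⁻¹`, then a brace cocycle is a coboundary as soon as the
associated cocycle of `Λ_H` is one. -/
theorem mem_B2Sb_of_cocycleMap_mem_B2 (hμ : ∀ h : H, T.μ h = AddEquiv.refl I)
    (hσ : ∀ h : H, (T.ν h).symm = T.σ h) {c : (H → H → I) × (H → H → I)} (hc : c ∈ T.Z2Sb)
    (hB : T.cocycleMap c.1 c.2 ∈ RightCohomology.B2 T.chi) : c ∈ T.B2Sb := by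
  obtain ⟨Θ, h0, hΘ⟩ := hB
  let η : H → H → I := fun h g => (Θ ⟨Multiplicative.ofAdd h, g⟩).1
  have η0 : η 0 1 = 0 := congrArg Prod.fst h0
  have key : ∀ h₁ g₁ h₂ g₂ : H,
      (T.ν (g₁ * g₂)).symm (c.1 h₁ (lam g₁ h₂) + (c.2 g₁ h₂ - c.1 g₁ (lam g₁ h₂))) =
        η h₂ g₂ - η (h₁ + lam g₁ h₂) (g₁ * g₂) + (T.ν g₂).symm (η h₁ g₁) := by
    intro h₁ g₁ h₂ g₂
    let y := (Θ ⟨Multiplicative.ofAdd h₁, g₁⟩).2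
    have h : (T.ν (g₁ * g₂)).symm (c.1 h₁ (lam g₁ h₂) + T.fMap c.1 c.2 g₁ h₂) =
        η h₂ g₂ - η (h₁ + lam g₁ h₂) (g₁ * g₂)
          + ((T.ν g₂).symm (T.μ h₂ (η h₁ g₁ - y)) + (T.ν g₂).symm (T.ν h₂ (T.σ h₂ y))) :=
      congrArg Prod.fst (hΘ ⟨Multiplicative.ofAdd h₁, g₁⟩ ⟨Multiplicative.ofAdd h₂, g₂⟩)
    -- Here `ν σ` cancels and `(η - y) + y = η`, so the second coordinate of `Θ` drops out.
    rw [fMap_eq hc, hμ, ← hσ, AddEquiv.apply_symm_apply, AddEquiv.refl_apply, ← map_add,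
      sub_add_cancel] at h
    exact h
  have hβ : ∀ a b, c.1 a b = η b 1 - η (a + b) 1 + η a 1 := by
    intro a b
    -- On the subgroup `(H, +)` of `Λ_H` the cocycle `φ` restricts to `β`.
    have h := key a 1 b 1
    have t : c.1 1 b = 0 := by rw [← zero_eq_one, beta_zero_left hc]
    rwa [mul_one, T.ν_one_symm, T.ν_one_symm, lam_one, tau_one_left hc, t, sub_zero,
      add_zero] at h
  have hη : ∀ h g, η h g = η 0 g + (T.ν g).symm (η h 1) := by
    intro h g
    -- The factorization `(h, g) = (h, 1)(0, g)`, on which `φ` vanishes, determines `η` from its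
    -- values on the two factors.
    have k := key h 1 0 g
    have t : c.2 1 0 = 0 := tau_one_left hc 0
    rw [one_mul, map_zero, beta_zero_right hc, beta_zero_right hc, t, sub_zero, add_zero,
      add_zero, map_zero] at k
    rw [← sub_eq_zero, ← neg_eq_zero, k]
    abel
  refine ⟨fun h => η h 1, η0, fun a b => ⟨?_, ?_⟩⟩
  · rw [hβ, hμ]; rfl
  -- The product `(0, a)(b, 1) = (λ_a(b), a)` isolates `τ(a, b) - β(a, λ_a(b))`; expanding `η` there
  -- by `hη` makes the unknown `η(0, a)` cancel.
  · have k := key 0 a b 1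
    rw [mul_one, zero_add, T.ν_one_symm, beta_zero_left hc, zero_add, hη (lam a b) a, hβ,
      add_lam, AddEquiv.symm_apply_eq] at k
    -- With `σ = ν⁻¹` the last term of the coboundary formula for `τ` is just `θ(a)`.
    rw [T.ν_mul, ← hσ, AddEquiv.apply_symm_apply, AddEquiv.apply_symm_apply]
    simp only [map_add, map_sub, AddEquiv.apply_symm_apply] at k
    rw [eq_add_of_sub_eq k]
    abel

/-! ### The induced map on cohomology -/

variable (T)

/-- The map `(β, τ) ↦ (φ_{β,τ}, τ̄)` on cocycles. -/
def cocycleHom : T.Z2Sb →+ RightCohomology.Z2 T.chi where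
  toFun c := ⟨T.cocycleMap c.1.1 c.1.2, cocycleMap_mem_Z2 c.2⟩
  map_zero' := by
    ext p q <;> simp [cocycleMap, phi, fMap, tauBar]
  map_add' c d := by
    ext p q
    · simp only [cocycleMap, phi, fMap, AddSubgroup.coe_add, Prod.fst_add, Prod.snd_add,
        Pi.add_apply, map_add, map_sub]
      abel
    · simp [cocycleMap, tauBar]

end GoodTriplet

theorem mainTheorem1 {H I : Type*} [SkewBrace H] [AddCommGroup I] (T : GoodTriplet H I) :
    ∃ Ψ : T.H2Sb →+ RightCohomology.H2 T.chi,
      (∀ c : T.Z2Sb, ∃ hc : T.cocycleMap c.1.1 c.1.2 ∈ RightCohomology.Z2 T.chi,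
        Ψ (QuotientAddGroup.mk c) =
          QuotientAddGroup.mk ⟨T.cocycleMap c.1.1 c.1.2, hc⟩) ∧
      ((∀ h : H, T.μ h = AddEquiv.refl I) → (∀ h : H, (T.ν h).symm = T.σ h) → Function.Injective Ψ) := by
  refine ⟨QuotientAddGroup.map _ _ T.cocycleHom fun c hc => ?_,
    fun c => ⟨GoodTriplet.cocycleMap_mem_Z2 c.2, rfl⟩, fun hμ hσ => ?_⟩
  · exact GoodTriplet.cocycleMap_mem_B2 (AddSubgroup.mem_addSubgroupOf.mp hc)
  · rw [injective_iff_map_eq_zero]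
    intro x
    induction x using QuotientAddGroup.induction_on with
    | H c =>
      intro h
      have h' : T.cocycleHom c ∈ (RightCohomology.B2 T.chi).addSubgroupOf _ :=
        (QuotientAddGroup.eq_zero_iff _).mp h
      exact (QuotientAddGroup.eq_zero_iff _).mpr (AddSubgroup.mem_addSubgroupOf.mpr
        (GoodTriplet.mem_B2Sb_of_cocycleMap_mem_B2 hμ hσ c.2
          (AddSubgroup.mem_addSubgroupOf.mp h')))
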